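/- All graphs are finite and simple. Let $G$ be a graph with a perfect matching $M$. For $X\subseteq V(G)$ let $D_X$ be the set of vertices of the odd components of $G-X$ (the connected components with an odd number of vertices), and let $q_G(X)$ be the number of these components. A *barrier* is a set $X\subseteq V(G)$ that maximizes $q_G(X)-|X|$ over all subsets of $V(G)$; a barrier $X$ is *odd-maximal* if $X\cup Y$ is not a barrier for any non-empty $Y\subseteq D_X$. An edge of a graph $H$ is *allowed* if some perfect matching of $H$ contains it. The *factor-components* of a graph $H$ that has a perfect matching are the subgraphs induced by the vertex sets of the connected components of the spanning subgraph formed by the allowed edges. Let $H$ be bipartite with colour classes $A,B$ and have a perfect matching. The *Dulmage–Mendelsohn order of $H$ with respect to $A$* is the partial order $\preceq$ on the factor-components of $H$ (then called *DM-components*) such that, for all factor-components $D,D'$: (i) if $H$ has an edge between $B\cap V(D)$ and $A\cap V(D')$, then $D\preceq D'$; (ii) if $D\preceq D'$ and no factor-component other than $D,D'$ lies between them, then $H$ has an edge between $B\cap V(D)$ and $A\cap V(D')$. A path $P$ of $G$ is *$M$-alternating* if $E(P)\setminus M$ is a matching. An *$M$-balanced path from $u$ to $v$* is an $M$-alternating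 path between $u$ and $v$ with an even number of edges (possibly $0$) such that $M\cap E(P)$ covers every vertex of $P$ except $v$, and does not cover $v$. An *$M$-saturated path* between $u$ and $w$ is an $M$-alternating path between $u$ and $w$ with an odd number of edges such that $M\cap E(P)$ is a perfect matching of $P$. **Theorem.** Let $G$ be a graph with a perfect matching $M$, and let $X$ be an odd-maximal barrier of $G$. Let $\hat G_X$ be the bipartite graph, with $X$ as one colour class, obtained from $G$ by deleting the even components of $G-X$, removing the edges with both ends in $X$, and contracting each odd component of $G-X$ into one vertex (identifying parallel edges). For a DM-component $D$ of $\hat G_X$, let its *expansion* $\hat D$ be the subgraph of $G$ induced by $V(D)\cap X$ together with the vertices of all odd components of $G-X$ whose contracted vertex belongs to $D$. Then for every $\alpha\in X\cup D_X$ there is exactly one DM-component $D_\alpha$ of $\hat G_X$ whose expansion contains $\alpha$; there is exactly one Dulmage–Mendelsohn order $\preceq$ of $\hat G_X$ with respect to $X$; and the following hold. 1. For all $u,v\in X$, there is an $M$-balanced path from $u$ to $v$ in $G$ if and only if $D_u\preceq D_v$. 2. For all $u\in X$ and $w\in D_X$, there is an $M$-saturated path between $u$ and $w$ in $G$ if and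 only if $D_u\preceq D_w$. -/

import Mathlib

namespace SimpleGraph

universe u

section Barriers

variable {V : Type u}

/-- The connected components of `G - X` that have an odd number of vertices. -/
abbrev OddComponent (G : SimpleGraph V) (X : Set V) : Type u :=
  {K : (G.induce Xᶜ).ConnectedComponent // Odd K.supp.ncard}

/-- The vertices of the odd components of `G - X`. -/
def oddVerts (G : SimpleGraph V) (X : Set V) : Set V :=
  {v | ∃ (h : v ∈ Xᶜ) (K : G.OddComponent X), (⟨v, h⟩ : ↥Xᶜ) ∈ K.1.supp}

/-- The surplus: number of odd components of `G - X` minus the number of vertices of `X`. -/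
noncomputable def oddSurplus (G : SimpleGraph V) (X : Set V) : ℤ :=
  (Nat.card (G.OddComponent X) : ℤ) - (X.ncard : ℤ)

/-- A barrier is a set of vertices attaining the maximum in the Berge formula
`|V| - 2 ν(G) = max_X (odd(G - X) - |X|)`. -/
def IsBarrier (G : SimpleGraph V) (X : Set V) : Prop :=
  ∀ Y : Set V, G.oddSurplus Y ≤ G.oddSurplus X

/-- A barrier that cannot be enlarged to a barrier by a non-empty set of vertices taken from
its odd components. -/
def IsOddMaximalBarrier (G : SimpleGraph V) (X : Set V) : Prop :=
  G.IsBarrier X ∧ ∀ Y : Set V, Y ⊆ G.oddVerts X → Y.Nonempty → ¬ G.IsBarrier (X ∪ Y)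

end Barriers

section AlternatingPaths

variable {V : Type u} {G : SimpleGraph V}

/-- A set of edges no two of which have a common vertex. -/
def IsEdgeMatching (F : Set (Sym2 V)) : Prop :=
  ∀ e ∈ F, ∀ f ∈ F, ∀ x : V, x ∈ e → x ∈ f → e = f

/-- A path `P` such that `E(P) \ M` is a matching. -/
def IsAlternatingPath (M : G.Subgraph) {a b : V} (P : G.Walk a b) : Prop :=
  P.IsPath ∧ IsEdgeMatching {e | e ∈ P.edges ∧ e ∉ M.edgeSet}

/-- An `M`-balanced path from `a` to `b`: an `M`-alternating path with an even number of edges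
such that `M ∩ E(P)` is a matching of `P` exposing `b` and no other vertex of `P`. -/
def IsBalancedPath (M : G.Subgraph) {a b : V} (P : G.Walk a b) : Prop :=
  IsAlternatingPath M P ∧ Even P.length ∧
    IsEdgeMatching {e | e ∈ P.edges ∧ e ∈ M.edgeSet} ∧
    ∀ x ∈ P.support, (∃ e ∈ P.edges, e ∈ M.edgeSet ∧ x ∈ e) ↔ x ≠ b

/-- An `M`-saturated path between `a` and `b`: an `M`-alternating path with an odd number of
edges such that `M ∩ E(P)` is a perfect matching of `P`. -/
def IsSaturatedPath (M : G.Subgraph) {a b : V} (P : G.Walk a b) : Prop :=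
  IsAlternatingPath M P ∧ Odd P.length ∧
    IsEdgeMatching {e | e ∈ P.edges ∧ e ∈ M.edgeSet} ∧
    ∀ x ∈ P.support, ∃ e ∈ P.edges, e ∈ M.edgeSet ∧ x ∈ e

end AlternatingPaths

section FactorComponents

variable {W : Type u}

/-- The spanning subgraph formed by the allowed edges, that is, the edges that belong to some
perfect matching. -/
def allowedGraph (H : SimpleGraph W) : SimpleGraph W where
  Adj a b := ∃ M : H.Subgraph, M.IsPerfectMatching ∧ M.Adj a b
  symm := ⟨fun _ _ ⟨M, hM, h⟩ => ⟨M, hM, h.symm⟩⟩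
  loopless := ⟨fun _ ⟨_, _, h⟩ => h.ne rfl⟩

/-- The factor-components of `H`, given by their vertex sets (`FactorComponent` is the type of
connected components of the graph of allowed edges; the factor-component itself is the subgraph
of `H` induced by `D.supp`). -/
abbrev FactorComponent (H : SimpleGraph W) : Type u := H.allowedGraph.ConnectedComponent

/-- `E_H[B ∩ V(D), A ∩ V(D')] ≠ ∅`. -/
def HasEdgeBetween (H : SimpleGraph W) (A B : Set W) (D D' : H.FactorComponent) : Prop :=
  ∃ b ∈ B ∩ D.supp, ∃ a ∈ A ∩ D'.supp, H.Adj b a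

/-- `le` is the Dulmage-Mendelsohn order, with respect to `A`, on the factor-components of the
bipartite graph `H` with colour classes `A` and `B`: a partial order such that an edge from
`B ∩ V(D)` to `A ∩ V(D')` forces `le D D'`, and such that there is an edge of this kind whenever
`le D D'` and no factor-component lies strictly between `D` and `D'`. -/
structure IsDMOrder (H : SimpleGraph W) (A B : Set W)
    (le : H.FactorComponent → H.FactorComponent → Prop) : Prop where
  refl : ∀ D, le D D
  trans : ∀ D₁ D₂ D₃, le D₁ D₂ → le D₂ D₃ → le D₁ D₃
  antisymm : ∀ D₁ D₂, le D₁ D₂ → le D₂ D₁ → D₁ = D₂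
  of_edge : ∀ D D', H.HasEdgeBetween A B D D' → le D D'
  edge_of_covers : ∀ D D', le D D' → (∀ E, le D E → le E D' → E = D ∨ E = D') →
    H.HasEdgeBetween A B D D'

end FactorComponents

section Contraction

variable {V : Type u}

/-- The bipartite graph obtained from `G` by deleting the even components of `G - X`, removing
the edges inside `X`, and contracting each odd component of `G - X` to one vertex (parallel edges
are identified and loops are dropped). -/
def barrierGraph (G : SimpleGraph V) (X : Set V) : SimpleGraph (↥X ⊕ G.OddComponent X) :=
  SimpleGraph.fromRel fun p q =>
    ∃ (x : ↥X) (K : G.OddComponent X) (y : ↥Xᶜ),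
      p = Sum.inl x ∧ q = Sum.inr K ∧ y ∈ K.1.supp ∧ G.Adj x y

/-- The DM-components of `barrierGraph G X`. -/
abbrev DMComponent (G : SimpleGraph V) (X : Set V) : Type u :=
  (G.barrierGraph X).FactorComponent

/-- The expansion of a DM-component `D`: the subgraph of `G` induced by the vertices of `D` that
lie in `X` and the vertices of the odd components whose contraction is in `D`. -/
def expansion (G : SimpleGraph V) (X : Set V) (D : G.DMComponent X) : G.Subgraph :=
  (⊤ : G.Subgraph).induce
    ({v | ∃ h : v ∈ X, Sum.inl ⟨v, h⟩ ∈ D.supp} ∪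
      {v | ∃ (h : v ∈ Xᶜ) (K : G.OddComponent X),
        (⟨v, h⟩ : ↥Xᶜ) ∈ K.1.supp ∧ Sum.inr K ∈ D.supp})

/-- The DM-order on the DM-components of `barrierGraph G X`, with respect to `X`. -/
def IsBarrierDMOrder (G : SimpleGraph V) (X : Set V)
    (le : G.DMComponent X → G.DMComponent X → Prop) : Prop :=
  (G.barrierGraph X).IsDMOrder (Set.range Sum.inl) (Set.range Sum.inr) le

end Contraction

end SimpleGraph

/-! Let `m` send each vertex to its `M`-partner. Since `X` is a barrier, `m` matches `X` bijectively
to the odd components (`IsBarrier.exists_equiv`); call the bijection `e`. Contracting this matching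
gives a digraph on `X`, with an arc from `x` to `y` when the component `e x` is adjacent to `y`.
Everything is compared with reachability in this digraph (`PartnerReach`).

On the bipartite side, an edge is allowed exactly when the matching can be shifted along a directed
cycle through it, so DM-components are the strong components. The covering axiom then forces a DM
order to be reachability (`IsDMOrder.le_mk_iff`).

On the side of `G`, split `X` and the odd components into cells, each made of some `x` and `e x`;
`M` pairs each cell within itself. An alternating path that enters a cell at `x` can leave only by a
non-matching edge into `X`, so it projects to a directed walk (`BalancedReach.partnerReach`).
Conversely, odd-maximality makes the odd components factor-critical
(`IsOddMaximalBarrier.exists_partner`). A near-perfect matching missing the exit vertex, combined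
with `M`, gives an alternating path across the cell (`BalancedReach.extend`), and these pieces are
joined along a simple directed path. Saturated paths are balanced paths with one more matching edge.
-/

namespace SimpleGraph

/-! ### Simple directed paths and the cyclic permutations they yield. -/

section SimpleReach

variable {α : Type*} {r : α → α → Prop} {t : α}

/-- `SimpleReach r t a S`: there is a directed path in `r` from `a` to `t` without repeated
vertices, and `S` is the set of its vertices. -/
inductive SimpleReach (r : α → α → Prop) (t : α) : α → Set α → Prop
  | refl : SimpleReach r t t {t}
  | head {a b : α} {S : Set α} : r a b → SimpleReach r t b S → a ∉ S →
      SimpleReach r t a (insert a S)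

theorem SimpleReach.target_mem {a : α} {S : Set α} (h : SimpleReach r t a S) : t ∈ S := by
  induction h with
  | refl => rfl
  | head _ _ _ ih => exact Set.mem_insert_of_mem _ ih

theorem SimpleReach.exists_of_mem {a b : α} {S : Set α} (h : SimpleReach r t a S) (hb : b ∈ S) :
    ∃ S', SimpleReach r t b S' := by
  induction h with
  | refl =>
    obtain rfl : b = t := hb
    exact ⟨_, .refl⟩
  | head h₁ h₂ h₃ ih =>
    rcases hb with rfl | hb
    · exact ⟨_, .head h₁ h₂ h₃⟩
    · exact ih hb

theorem SimpleReach.of_reflTransGen {a : α} (h : Relation.ReflTransGen r a t) :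
    ∃ S, SimpleReach r t a S := by
  induction h using Relation.ReflTransGen.head_induction_on with
  | refl => exact ⟨_, .refl⟩
  | @head a b h₁ _ ih =>
    obtain ⟨S, hS⟩ := ih
    by_cases ha : a ∈ S
    · exact hS.exists_of_mem ha
    · exact ⟨_, .head h₁ hS ha⟩

/-- A simple directed path from `a` to `t` closes up to a permutation sending `t` to `a`, and every
other moved point to an out-neighbour. -/
theorem SimpleReach.exists_perm {a : α} {S : Set α} (h : SimpleReach r t a S) :
    ∃ σ : Equiv.Perm α, σ t = a ∧ (∀ x, x ≠ t → σ x = x ∨ r x (σ x)) ∧ ∀ x ∉ S, σ x = x := by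
  classical
  induction h with
  | refl => exact ⟨1, rfl, fun _ _ => .inl rfl, fun _ _ => rfl⟩
  | @head a b S h₁ h₂ h₃ ih =>
    obtain ⟨σ, hσt, hσ, hσS⟩ := ih
    have hat : a ≠ t := fun h => h₃ (h ▸ h₂.target_mem)
    refine ⟨σ * Equiv.swap t a, by simp [hσS a h₃], fun x hx => ?_, fun x hx => ?_⟩
    · by_cases hxa : x = a
      · subst hxa
        simp [hσt, h₁]
      · simpa [Equiv.swap_apply_of_ne_of_ne hx hxa] using hσ x hx
    · have hxa : x ≠ a := fun h => hx (h ▸ Set.mem_insert _ _)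
      have hxS : x ∉ S := fun h => hx (Set.mem_insert_of_mem _ h)
      have hxt : x ≠ t := fun h => hxS (h ▸ h₂.target_mem)
      simp [Equiv.swap_apply_of_ne_of_ne hxt hxa, hσS x hxS]

end SimpleReach

/-! ### The Dulmage–Mendelsohn order as reachability. -/

section DulmageMendelsohn

universe u

variable {α β : Type u} {H : SimpleGraph (α ⊕ β)}

/-- The perfect matching of a graph on `α ⊕ β` given by a bijection between the two sides. -/
def subgraphOfEquiv (H : SimpleGraph (α ⊕ β)) (σ : α ≃ β)
    (h : ∀ x, H.Adj (.inl x) (.inr (σ x))) : H.Subgraph where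
  verts := Set.univ
  Adj p q := (∃ x, p = .inl x ∧ q = .inr (σ x)) ∨ ∃ x, q = .inl x ∧ p = .inr (σ x)
  adj_sub := by
    rintro p q (⟨x, rfl, rfl⟩ | ⟨x, rfl, rfl⟩)
    · exact h x
    · exact (h x).symm
  edge_vert _ := Set.mem_univ _
  symm := ⟨fun _ _ h => h.symm⟩

theorem subgraphOfEquiv_isPerfectMatching (σ : α ≃ β) (h : ∀ x, H.Adj (.inl x) (.inr (σ x))) :
    (H.subgraphOfEquiv σ h).IsPerfectMatching := by
  rw [Subgraph.isPerfectMatching_iff]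
  rintro (x | y)
  · refine ⟨.inr (σ x), .inl ⟨x, rfl, rfl⟩, ?_⟩
    rintro q (⟨z, hz, rfl⟩ | ⟨z, rfl, hz⟩)
    · rw [Sum.inl.inj hz]
    · cases hz
  · refine ⟨.inl (σ.symm y), .inr ⟨σ.symm y, rfl, by simp⟩, ?_⟩
    rintro q (⟨z, hz, rfl⟩ | ⟨z, rfl, hz⟩)
    · cases hz
    · rw [Sum.inr.inj hz]; simp

theorem allowedGraph_adj_of_equiv (σ : α ≃ β) (h : ∀ x, H.Adj (.inl x) (.inr (σ x))) (x : α) :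
    H.allowedGraph.Adj (.inl x) (.inr (σ x)) :=
  ⟨_, subgraphOfEquiv_isPerfectMatching σ h, .inl ⟨x, rfl, rfl⟩⟩

/-- Graphs on `α ⊕ β` whose edges all join `α` to `β`. -/
structure IsSumBipartite (H : SimpleGraph (α ⊕ β)) : Prop where
  left : ∀ x y : α, ¬ H.Adj (.inl x) (.inl y)
  right : ∀ x y : β, ¬ H.Adj (.inr x) (.inr y)

theorem IsSumBipartite.exists_equiv (hH : H.IsSumBipartite) {N : H.Subgraph}
    (hN : N.IsPerfectMatching) : ∃ σ : α ≃ β, ∀ x, N.Adj (.inl x) (.inr (σ x)) := by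
  rw [Subgraph.isPerfectMatching_iff] at hN
  have hf : ∀ x : α, ∃ y : β, N.Adj (.inl x) (.inr y) := fun x => by
    obtain ⟨y | y, hy, -⟩ := hN (.inl x)
    · exact (hH.left _ _ hy.adj_sub).elim
    · exact ⟨y, hy⟩
  have hg : ∀ y : β, ∃ x : α, N.Adj (.inl x) (.inr y) := fun y => by
    obtain ⟨x | x, hx, -⟩ := hN (.inr y)
    · exact ⟨x, hx.symm⟩
    · exact (hH.right _ _ hx.adj_sub).elim
  choose f hf using hf
  choose g hg using hg
  exact ⟨⟨f, g, fun x => Sum.inl.inj ((hN (.inr (f x))).unique (hg _).symm (hf x).symm),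
    fun y => Sum.inr.inj ((hN (.inl (g y))).unique (hf _) (hg y))⟩, hf⟩

variable (H) in
/-- `x` steps to `y` if the partner of `x` is adjacent to `y`. -/
def PartnerStep (e : α ≃ β) (x y : α) : Prop := H.Adj (.inr (e x)) (.inl y)

variable (H) in
/-- Reachability in the digraph obtained by contracting the matching `e`. -/
abbrev PartnerReach (e : α ≃ β) : α → α → Prop := Relation.ReflTransGen (H.PartnerStep e)

/-- The end in `α` of the matching edge at a vertex. -/
def leftEnd (e : α ≃ β) : α ⊕ β → α := Sum.elim id e.symm

variable {e : α ≃ β}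

/-- A perfect matching `σ` through the edge gives the permutation `τ = e⁻¹ ∘ σ` of `α`, and each `τ
a` steps to `a`. Thus `x = τ y` steps to `y`, and following the finite cycle of `τ` leads from `y`
back to `x`. -/
theorem IsSumBipartite.partnerReach_of_allowed [Finite α] (hH : H.IsSumBipartite) {x y : α}
    (h : H.allowedGraph.Adj (.inl y) (.inr (e x))) :
    H.PartnerReach e x y ∧ H.PartnerReach e y x := by
  obtain ⟨N, hN, hyx⟩ := h
  obtain ⟨σ, hσ⟩ := hH.exists_equiv hN
  have hy : σ y = e x :=
    Sum.inr.inj ((Subgraph.isPerfectMatching_iff.mp hN (.inl y)).unique (hσ y) hyx)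
  let τ : Equiv.Perm α := σ.trans e.symm
  have hτ : ∀ a, H.PartnerStep e (τ a) a := fun a => by
    simpa [PartnerStep, τ] using (hσ a).adj_sub.symm
  have hτy : τ y = x := by simp [τ, hy]
  refine ⟨.single (hτy ▸ hτ y), ?_⟩
  have key : ∀ k : ℕ, H.PartnerReach e ((τ ^ k) x) x := fun k => by
    induction k with
    | zero => exact .refl
    | succ k ih =>
      rw [pow_succ']
      exact .head (hτ _) ih
  -- For this exponent `τ ^ k` is the inverse of `τ`, so it sends `x` to `y`.
  have hk := key (orderOf τ - 1)
  rw [← hτy, ← Equiv.Perm.mul_apply, ← pow_succ,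
    Nat.sub_add_cancel (isOfFinOrder_of_finite τ).orderOf_pos, pow_orderOf_eq_one] at hk
  simpa [hτy] using hk

theorem IsSumBipartite.partnerReach_of_adj [Finite α] (hH : H.IsSumBipartite) {p q : α ⊕ β}
    (h : H.allowedGraph.Adj p q) : H.PartnerReach e (leftEnd e p) (leftEnd e q) := by
  obtain ⟨N, hN, hpq⟩ := id h
  rcases p with x | x <;> rcases q with y | y
  · exact (hH.left _ _ hpq.adj_sub).elim
  · exact (hH.partnerReach_of_allowed (x := e.symm y) (y := x) (by simpa using h)).2
  · exact (hH.partnerReach_of_allowed (x := e.symm x) (y := y) (by simpa using h.symm)).1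
  · exact (hH.right _ _ hpq.adj_sub).elim

theorem IsSumBipartite.partnerReach_of_mk_eq [Finite α] (hH : H.IsSumBipartite) {p q : α ⊕ β}
    (h : H.allowedGraph.connectedComponentMk p = H.allowedGraph.connectedComponentMk q) :
    H.PartnerReach e (leftEnd e p) (leftEnd e q) := by
  obtain ⟨w⟩ := ConnectedComponent.exact h
  induction w with
  | nil => exact .refl
  | cons hadj w ih =>
    exact (hH.partnerReach_of_adj hadj).trans (ih (ConnectedComponent.sound ⟨w⟩))

theorem mk_leftEnd (he : ∀ x, H.Adj (.inl x) (.inr (e x))) (p : α ⊕ β) :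
    H.allowedGraph.connectedComponentMk (.inl (leftEnd e p)) =
      H.allowedGraph.connectedComponentMk p := by
  rcases p with x | y
  · rfl
  · refine ConnectedComponent.sound (Adj.reachable ?_)
    simpa [leftEnd] using allowedGraph_adj_of_equiv e he (e.symm y)

theorem mk_inr (he : ∀ x, H.Adj (.inl x) (.inr (e x))) (x : α) :
    H.allowedGraph.connectedComponentMk (.inr (e x)) =
      H.allowedGraph.connectedComponentMk (.inl x) := by
  simpa [leftEnd] using (mk_leftEnd he (.inr (e x))).symm

theorem hasEdgeBetween_of_partnerStep (he : ∀ x, H.Adj (.inl x) (.inr (e x))) {x y : α}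
    (h : H.PartnerStep e x y) :
    H.HasEdgeBetween (Set.range .inl) (Set.range .inr)
      (H.allowedGraph.connectedComponentMk (.inl x))
      (H.allowedGraph.connectedComponentMk (.inl y)) :=
  ⟨.inr (e x), ⟨⟨_, rfl⟩, mk_inr he x⟩, .inl y, ⟨⟨_, rfl⟩, rfl⟩, h⟩

theorem HasEdgeBetween.exists_partnerStep (he : ∀ x, H.Adj (.inl x) (.inr (e x)))
    {D D' : H.FactorComponent} (h : H.HasEdgeBetween (Set.range .inl) (Set.range .inr) D D') :
    ∃ x y, H.PartnerStep e x y ∧ H.allowedGraph.connectedComponentMk (.inl x) = D ∧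
      H.allowedGraph.connectedComponentMk (.inl y) = D' := by
  obtain ⟨_, ⟨⟨b, rfl⟩, hb⟩, _, ⟨⟨a, rfl⟩, ha⟩, h⟩ := h
  refine ⟨e.symm b, a, by simpa [PartnerStep] using h, ?_, ha⟩
  rw [← mk_inr he]
  simpa using hb

/-- Two vertices that reach each other lie in the same factor-component. -/
theorem mk_eq_of_partnerStep (he : ∀ x, H.Adj (.inl x) (.inr (e x))) {x y : α}
    (h : H.PartnerStep e x y) (h' : H.PartnerReach e y x) :
    H.allowedGraph.connectedComponentMk (.inl x) =
      H.allowedGraph.connectedComponentMk (.inl y) := by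
  obtain ⟨S, hS⟩ := SimpleReach.of_reflTransGen h'
  obtain ⟨σ, hσx, hσ, -⟩ := hS.exists_perm
  -- Shifting `e` along the directed cycle gives the perfect matching `e ∘ σ⁻¹`, which contains the
  -- edge between `y` and `e x`.
  have hadj : ∀ a, H.Adj (.inl a) (.inr ((σ.symm.trans e) a)) := fun a => by
    by_cases hax : σ.symm a = x
    · have : a = y := by rw [← hσx, ← hax]; simp
      rw [Equiv.trans_apply, hax, this]
      exact h.symm
    · rcases hσ _ hax with ha | ha
      · have : σ.symm a = a := by simpa using ha.symm
        simpa [this] using he a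
      · simpa [PartnerStep] using ha.symm
  have := allowedGraph_adj_of_equiv _ hadj y
  rw [show (σ.symm.trans e) y = e x by simp [← hσx]] at this
  rw [← mk_inr he]
  exact ConnectedComponent.sound this.symm.reachable

theorem mk_eq_of_partnerReach (he : ∀ x, H.Adj (.inl x) (.inr (e x))) {x y : α}
    (h : H.PartnerReach e x y) (h' : H.PartnerReach e y x) :
    H.allowedGraph.connectedComponentMk (.inl x) =
      H.allowedGraph.connectedComponentMk (.inl y) := by
  induction h using Relation.ReflTransGen.head_induction_on with
  | refl => rfl
  | head h₁ h₂ ih => exact (mk_eq_of_partnerStep he h₁ (h₂.trans h')).trans (ih (h'.tail h₁))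

theorem IsDMOrder.le_of_partnerReach (he : ∀ x, H.Adj (.inl x) (.inr (e x)))
    {le : H.FactorComponent → H.FactorComponent → Prop}
    (hle : H.IsDMOrder (Set.range .inl) (Set.range .inr) le) {x y : α}
    (h : H.PartnerReach e x y) :
    le (H.allowedGraph.connectedComponentMk (.inl x))
      (H.allowedGraph.connectedComponentMk (.inl y)) := by
  induction h with
  | refl => exact hle.refl _
  | tail _ h ih => exact hle.trans _ _ _ ih (hle.of_edge _ _ (hasEdgeBetween_of_partnerStep he h))

/-- Induction on the size of the interval from `D` to `D'`. If nothing lies strictly between, the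
covering axiom supplies an arc, and inside a factor-component all vertices reach each other;
otherwise the interval splits at an intermediate `E`. -/
theorem IsDMOrder.partnerReach_of_le [Finite α] (hH : H.IsSumBipartite)
    (he : ∀ x, H.Adj (.inl x) (.inr (e x)))
    {le : H.FactorComponent → H.FactorComponent → Prop}
    (hle : H.IsDMOrder (Set.range .inl) (Set.range .inr) le) {D D' : H.FactorComponent}
    (h : le D D') {x y : α} (hx : H.allowedGraph.connectedComponentMk (.inl x) = D)
    (hy : H.allowedGraph.connectedComponentMk (.inl y) = D') : H.PartnerReach e x y := by
  have : Finite β := .of_equiv α e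
  have : Finite H.FactorComponent := Quot.finite _
  induction hn : {E | le D E ∧ le E D'}.ncard using Nat.strong_induction_on
    generalizing D D' x y with
  | _ n ih =>
    subst hn
    by_cases hE : ∀ E, le D E → le E D' → E = D ∨ E = D'
    · obtain ⟨a, b, hab, ha, hb⟩ := (hle.edge_of_covers D D' h hE).exists_partnerStep he
      exact ((hH.partnerReach_of_mk_eq (hx.trans ha.symm)).tail hab).trans
        (hH.partnerReach_of_mk_eq (hb.trans hy.symm))
    · push Not at hE
      obtain ⟨E, h₁, h₂, hED, hED'⟩ := hE
      obtain ⟨p, rfl⟩ := E.exists_rep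
      have hp := mk_leftEnd he p
      refine (ih _ (Set.ncard_lt_ncard ?_) h₁ hx hp rfl).trans
        (ih _ (Set.ncard_lt_ncard ?_) h₂ hp hy rfl)
      · refine ⟨fun F hF => ⟨hF.1, hle.trans _ _ _ hF.2 h₂⟩, fun hsub => hED' ?_⟩
        exact hle.antisymm _ _ h₂ (hsub ⟨h, hle.refl _⟩).2
      · refine ⟨fun F hF => ⟨hle.trans _ _ _ h₁ hF.1, hF.2⟩, fun hsub => hED ?_⟩
        exact hle.antisymm _ _ (hsub ⟨hle.refl _, h⟩).1 h₁

theorem IsDMOrder.le_mk_iff [Finite α] (hH : H.IsSumBipartite)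
    (he : ∀ x, H.Adj (.inl x) (.inr (e x)))
    {le : H.FactorComponent → H.FactorComponent → Prop}
    (hle : H.IsDMOrder (Set.range .inl) (Set.range .inr) le) (p q : α ⊕ β) :
    le (H.allowedGraph.connectedComponentMk p) (H.allowedGraph.connectedComponentMk q) ↔
      H.PartnerReach e (leftEnd e p) (leftEnd e q) := by
  refine ⟨fun h => hle.partnerReach_of_le hH he h (mk_leftEnd he p) (mk_leftEnd he q),
    fun h => ?_⟩
  rw [← mk_leftEnd he p, ← mk_leftEnd he q]
  exact hle.le_of_partnerReach he h

/-- The Dulmage–Mendelsohn order exists and is unique. -/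
theorem IsSumBipartite.existsUnique_isDMOrder [Finite α] (hH : H.IsSumBipartite)
    (he : ∀ x, H.Adj (.inl x) (.inr (e x))) :
    ∃! le : H.FactorComponent → H.FactorComponent → Prop,
      H.IsDMOrder (Set.range .inl) (Set.range .inr) le := by
  refine existsUnique_of_exists_of_unique ?_ ?_
  · let mk : α → H.FactorComponent := fun x => H.allowedGraph.connectedComponentMk (.inl x)
    have hmk : ∀ D, ∃ x, mk x = D := fun D => by
      obtain ⟨p, rfl⟩ := D.exists_rep
      exact ⟨_, mk_leftEnd he p⟩
    have hreach : ∀ x y, mk x = mk y → H.PartnerReach e x y := fun x y h =>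
      hH.partnerReach_of_mk_eq (e := e) h
    refine ⟨fun D D' => ∃ x y, mk x = D ∧ mk y = D' ∧ H.PartnerReach e x y, ?_, ?_, ?_, ?_, ?_⟩
    · intro D
      obtain ⟨x, hx⟩ := hmk D
      exact ⟨x, x, hx, hx, .refl⟩
    · rintro _ _ _ ⟨x, y, rfl, rfl, h⟩ ⟨y', z, hy, rfl, h'⟩
      exact ⟨x, z, rfl, rfl, (h.trans (hreach _ _ hy.symm)).trans h'⟩
    · rintro _ _ ⟨x, y, rfl, rfl, h⟩ ⟨y', x', hy, hx, h'⟩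
      exact mk_eq_of_partnerReach he h
        (((hreach _ _ hy.symm).trans h').trans (hreach _ _ hx))
    · intro D D' h
      obtain ⟨x, y, hxy, rfl, rfl⟩ := h.exists_partnerStep he
      exact ⟨x, y, rfl, rfl, .single hxy⟩
    · rintro _ _ ⟨x, y, rfl, rfl, h⟩ hE
      -- The covering axiom also applies to `D = D'`, where a matching edge serves.
      have self : ∀ a, H.HasEdgeBetween (Set.range .inl) (Set.range .inr) (mk a) (mk a) :=
        fun a => hasEdgeBetween_of_partnerStep he (he a).symm
      induction h using Relation.ReflTransGen.head_induction_on with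
      | refl => exact self _
      | @head x z h₁ h₂ ih =>
        -- The class of `z` lies in the interval. Either the path has not yet left the first class,
        -- or its first arc already enters the last one.
        rcases hE (mk z) ⟨x, z, rfl, rfl, .single h₁⟩ ⟨z, y, rfl, rfl, h₂⟩ with hz | hz
        · rw [← hz] at hE ⊢
          exact ih hE
        · rw [← hz]
          exact hasEdgeBetween_of_partnerStep he h₁
  · intro le₁ le₂ h₁ h₂
    ext D D'
    obtain ⟨p, rfl⟩ := D.exists_rep
    obtain ⟨q, rfl⟩ := D'.exists_rep
    exact (h₁.le_mk_iff hH he p q).trans (h₂.le_mk_iff hH he p q).symm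

end DulmageMendelsohn

/-! ### Alternating paths as an inductive reachability relation. -/

section BalancedReach

variable {V : Type u} {G : SimpleGraph V} {M : G.Subgraph} {m : V → V}

/-- `BalancedReach G m t u T`: there is a path from `u` to `t` which uses alternately edges
`{a, m a}` and other edges of `G`, starting with the former and ending with the latter kind; `T` is
the set of its vertices. -/
inductive BalancedReach (G : SimpleGraph V) (m : V → V) (t : V) : V → Set V → Prop
  | refl : BalancedReach G m t t {t}
  | head {u b : V} {T : Set V} : G.Adj (m u) b → BalancedReach G m t b T → u ∉ T → m u ∉ T →
      BalancedReach G m t u (insert u (insert (m u) T))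

theorem BalancedReach.target_mem {t u : V} {T : Set V} (h : BalancedReach G m t u T) : t ∈ T := by
  induction h with
  | refl => rfl
  | head _ _ _ _ ih => exact .inr (.inr ih)

theorem Walk.IsPath.eq_of_mem_edges_of_start_mem {a b : V} {P : G.Walk a b} (hP : P.IsPath)
    {e f : Sym2 V} (he : e ∈ P.edges) (hf : f ∈ P.edges) (hae : a ∈ e) (haf : a ∈ f) : e = f := by
  cases P with
  | nil => simp at he
  | cons h q =>
    rw [Walk.cons_isPath_iff] at hP
    have key : ∀ g ∈ (Walk.cons h q).edges, a ∈ g → g = s(a, _) := fun g hg hag => by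
      rcases List.mem_cons.mp hg with rfl | hg
      · rfl
      · exact (hP.2 (Walk.mem_support_of_mem_edges hg hag)).elim
    rw [key e he hae, key f hf haf]

variable (hm : ∀ a b, M.Adj a b ↔ m a = b)
include hm

theorem partner_partner (a : V) : m (m a) = a := (hm _ _).mp ((hm a _).mpr rfl).symm

theorem partner_ne (a : V) : m a ≠ a := ((hm a _).mpr rfl).ne.symm

theorem isEdgeMatching_subgraph (s : Set (Sym2 V)) : IsEdgeMatching {e | e ∈ s ∧ e ∈ M.edgeSet} := by
  rintro e ⟨-, he⟩ f ⟨-, hf⟩ x hxe hxf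
  obtain ⟨y, rfl⟩ := hxe
  obtain ⟨z, rfl⟩ := hxf
  rw [Subgraph.mem_edgeSet, hm] at he hf
  rw [← he, ← hf]

/-- The new edge from `m u` to `b` could meet another non-matching edge only at `b`, but the sole
edge of `P` at `b` is in `M`. For `b = t` the path `P` is trivial and needs no covering. -/
theorem IsAlternatingPath.cons_cons {u b t : V} {P : G.Walk b t} (hP : IsAlternatingPath M P)
    (hu : G.Adj u (m u)) (hb : G.Adj (m u) b) (hu' : u ∉ P.support) (hmu : m u ∉ P.support)
    (hcov : b ≠ t → ∃ e ∈ P.edges, e ∈ M.edgeSet ∧ b ∈ e) :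
    IsAlternatingPath M (.cons hu (.cons hb P)) := by
  have hpath := hP.1
  have hnew : ∀ f ∈ P.edges, f ∉ M.edgeSet → ∀ x ∈ s(m u, b), x ∉ f := by
    intro f hf hfM x hx hxf
    rcases Sym2.mem_iff.mp hx with rfl | rfl
    · exact hmu (Walk.mem_support_of_mem_edges hf hxf)
    · by_cases hbt : x = t
      · subst hbt
        rw [(Walk.isPath_iff_nil.mp hpath).eq_nil] at hf
        simp at hf
      · obtain ⟨e, he, heM, hxe⟩ := hcov hbt
        exact hfM (hpath.eq_of_mem_edges_of_start_mem hf he hxf hxe ▸ heM)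
  refine ⟨?_, ?_⟩
  · simp [Walk.cons_isPath_iff, hpath, hu', hmu, (partner_ne hm u).symm]
  · have hmem : ∀ g, g ∈ (Walk.cons hu (.cons hb P)).edges ∧ g ∉ M.edgeSet →
        g = s(m u, b) ∨ g ∈ P.edges := by
      rintro g ⟨hg, hgM⟩
      rw [Walk.edges_cons, Walk.edges_cons, List.mem_cons, List.mem_cons] at hg
      refine hg.resolve_left ?_
      rintro rfl
      exact hgM ((hm _ _).mpr rfl)
    intro e he f hf x hxe hxf
    rcases hmem e he with rfl | he' <;> rcases hmem f hf with rfl | hf'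
    · rfl
    · exact (hnew f hf' hf.2 x hxe hxf).elim
    · exact (hnew e he' he.2 x hxf hxe).elim
    · exact hP.2 e ⟨he', he.2⟩ f ⟨hf', hf.2⟩ x hxe hxf

theorem covered_cons_cons_iff {u b t : V} {P : G.Walk b t} (hu : G.Adj u (m u))
    (hb : G.Adj (m u) b) (hu' : u ∉ P.support) (hmu : m u ∉ P.support) (x : V) :
    (∃ e ∈ (Walk.cons hu (.cons hb P)).edges, e ∈ M.edgeSet ∧ x ∈ e) ↔
      x = u ∨ x = m u ∨ ∃ e ∈ P.edges, e ∈ M.edgeSet ∧ x ∈ e := by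
  constructor
  · rintro ⟨e, he, heM, hx⟩
    rw [Walk.edges_cons, Walk.edges_cons, List.mem_cons, List.mem_cons] at he
    rcases he with rfl | rfl | he
    · rcases Sym2.mem_iff.mp hx with h | h
      · exact .inl h
      · exact .inr (.inl h)
    · rw [Subgraph.mem_edgeSet, hm, partner_partner hm] at heM
      exact (hu' (heM ▸ P.start_mem_support)).elim
    · exact .inr (.inr ⟨e, he, heM, hx⟩)
  · rintro (rfl | rfl | ⟨e, he, h⟩)
    · exact ⟨s(x, m x), by simp, (hm _ _).mpr rfl, by simp⟩
    · exact ⟨s(u, m u), by simp, (hm _ _).mpr rfl, by simp⟩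
    · exact ⟨e, by simp [he], h⟩

theorem BalancedReach.exists_isBalancedPath {u t : V} {T : Set V} (h : BalancedReach G m t u T) :
    ∃ P : G.Walk u t, IsBalancedPath M P ∧ ∀ x, x ∈ P.support ↔ x ∈ T := by
  induction h with
  | refl =>
    refine ⟨.nil, ⟨⟨.nil, ?_⟩, by simp, ?_, ?_⟩, by simp⟩ <;> simp [IsEdgeMatching]
  | @head u b T h₁ h₂ h₃ h₄ ih =>
    obtain ⟨P, ⟨hP, hev, -, hcov⟩, hT⟩ := ih
    have hu : G.Adj u (m u) := ((hm _ _).mpr rfl).adj_sub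
    rw [← hT] at h₃ h₄
    refine ⟨.cons hu (.cons h₁ P), ⟨hP.cons_cons hm hu h₁ h₃ h₄
      (hcov b P.start_mem_support).mpr, by simpa [Nat.even_add_one] using hev,
      isEdgeMatching_subgraph hm _, fun x hx => ?_⟩, by simp [hT]⟩
    rw [covered_cons_cons_iff hm hu h₁ h₃ h₄]
    have htu : t ≠ u := fun h => h₃ (h ▸ P.end_mem_support)
    have htm : t ≠ m u := fun h => h₄ (h ▸ P.end_mem_support)
    by_cases hxu : x = u
    · simp [hxu, htu.symm]
    by_cases hxm : x = m u
    · simp [hxm, htm.symm]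
    simpa [hxu, hxm] using hcov x (by simpa [hxu, hxm] using hx)

/-- The matching edge at `t` is appended. Its end `m t` is new because the vertices of `T` other
than `t` come in matched pairs. -/
theorem BalancedReach.exists_isSaturatedPath {u t : V} {T : Set V} (h : BalancedReach G m t u T) :
    ∃ P : G.Walk u (m t), IsSaturatedPath M P ∧ ∀ x, x ∈ P.support ↔ x ∈ T ∨ x = m t := by
  induction h with
  | refl =>
    have ht : G.Adj t (m t) := ((hm _ _).mpr rfl).adj_sub
    refine ⟨.cons ht .nil, ⟨⟨by simpa using (partner_ne hm t).symm, ?_⟩, by simp,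
      isEdgeMatching_subgraph hm _, fun x hx => ⟨s(t, m t), by simp, (hm _ _).mpr rfl, ?_⟩⟩,
      by simp⟩
    · rintro e ⟨he, -⟩ f ⟨hf, -⟩ - - -
      simp at he hf
      rw [he, hf]
    · simpa using hx
  | @head u b T h₁ h₂ h₃ h₄ ih =>
    obtain ⟨P, ⟨hP, hodd, -, hcov⟩, hT⟩ := ih
    have hu : G.Adj u (m u) := ((hm _ _).mpr rfl).adj_sub
    have hu' : u ∉ P.support := by
      rw [hT]
      rintro (h | rfl)
      · exact h₃ h
      · rw [partner_partner hm] at h₄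
        exact h₄ h₂.target_mem
    have hmu : m u ∉ P.support := by
      rw [hT]
      rintro (h | h)
      · exact h₄ h
      · rw [← partner_partner hm u, h, partner_partner hm] at h₃
        exact h₃ h₂.target_mem
    refine ⟨.cons hu (.cons h₁ P), ⟨hP.cons_cons hm hu h₁ hu' hmu
      fun _ => hcov b P.start_mem_support, by simpa [Nat.odd_add_one] using hodd,
      isEdgeMatching_subgraph hm _, fun x hx => ?_⟩, by simp [hT, or_assoc]⟩
    rw [covered_cons_cons_iff hm hu h₁ hu' hmu]
    rcases (by simpa using hx : x = u ∨ x = m u ∨ x ∈ P.support) with h | h | h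
    · exact .inl h
    · exact .inr (.inl h)
    · exact .inr (.inr (hcov x h))

theorem eq_partner_of_covered_start {u c t : V} {h : G.Adj u c} {P : G.Walk c t}
    (hP : (Walk.cons h P).IsPath) (hcov : ∃ e ∈ (Walk.cons h P).edges, e ∈ M.edgeSet ∧ u ∈ e) :
    c = m u := by
  obtain ⟨e, he, heM, hue⟩ := hcov
  have := hP.eq_of_mem_edges_of_start_mem he (f := s(u, c)) (by simp) hue (by simp)
  rw [this, Subgraph.mem_edgeSet, hm] at heM
  exact heM.symm

/-- Two edges are peeled off at a time: `u` is covered, so the first edge goes to `m u`; parity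
excludes stopping there, and the rest is again balanced. -/
theorem IsBalancedPath.exists_balancedReach {u t : V} {P : G.Walk u t} (hP : IsBalancedPath M P) :
    ∃ T, BalancedReach G m t u T ∧ ∀ x ∈ T, x ∈ P.support := by
  induction hn : P.length using Nat.strong_induction_on generalizing u with
  | _ n ih =>
    subst hn
    obtain ⟨⟨hpath, halt⟩, hev, -, hcov⟩ := hP
    match P with
    | .nil => exact ⟨_, .refl, by simp⟩
    | .cons h q =>
      have hut : u ≠ t := by
        rintro rfl
        simpa using Walk.isPath_iff_nil.mp hpath
      obtain rfl := eq_partner_of_covered_start hm hpath ((hcov u (by simp)).mpr hut)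
      match q with
      | .nil => simp at hev
      | .cons (v := b) h' p =>
        have hpath' := hpath
        simp only [Walk.cons_isPath_iff, Walk.support_cons, List.mem_cons, not_or] at hpath'
        obtain ⟨⟨hpp, hmp⟩, -, hup⟩ := hpath'
        obtain ⟨T, hT, hTp⟩ := ih p.length (by simp) (P := p)
          ⟨⟨hpp, fun e he f hf => halt e ⟨by simp [he.1], he.2⟩ f ⟨by simp [hf.1], hf.2⟩⟩,
          by simpa [Nat.even_add_one] using hev, isEdgeMatching_subgraph hm {e | e ∈ p.edges},
          fun x hx => by
            have hxu : x ≠ u := fun h => hup (h ▸ hx)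
            have hxm : x ≠ m u := fun h => hmp (h ▸ hx)
            rw [← hcov x (by simp [hx]), covered_cons_cons_iff hm h h' hup hmp]
            simp [hxu, hxm]⟩ rfl
        refine ⟨_, .head h' hT (fun h => hup (hTp _ h)) (fun h => hmp (hTp _ h)), ?_⟩
        rintro x (rfl | rfl | hx)
        · simp
        · simp
        · simp [hTp x hx]

theorem IsSaturatedPath.exists_balancedReach {u w : V} {P : G.Walk u w}
    (hP : IsSaturatedPath M P) :
    ∃ T, BalancedReach G m (m w) u T ∧ ∀ x ∈ T, x ∈ P.support := by
  induction hn : P.length using Nat.strong_induction_on generalizing u with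
  | _ n ih =>
    subst hn
    obtain ⟨⟨hpath, halt⟩, hodd, -, hcov⟩ := hP
    match P with
    | .nil => simp at hodd
    | .cons h q =>
      obtain rfl := eq_partner_of_covered_start hm hpath (hcov u (by simp))
      match q with
      | .nil =>
        rw [partner_partner hm]
        exact ⟨_, .refl, by simp⟩
      | .cons (v := b) h' p =>
        have hpath' := hpath
        simp only [Walk.cons_isPath_iff, Walk.support_cons, List.mem_cons, not_or] at hpath'
        obtain ⟨⟨hpp, hmp⟩, -, hup⟩ := hpath'
        obtain ⟨T, hT, hTp⟩ := ih p.length (by simp) (P := p)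
          ⟨⟨hpp, fun e he f hf => halt e ⟨by simp [he.1], he.2⟩ f ⟨by simp [hf.1], hf.2⟩⟩,
          by simpa [Nat.odd_add_one] using hodd, isEdgeMatching_subgraph hm {e | e ∈ p.edges},
          fun x hx => by
            have hxu : x ≠ u := fun h => hup (h ▸ hx)
            have hxm : x ≠ m u := fun h => hmp (h ▸ hx)
            have := hcov x (by simp [hx])
            rw [covered_cons_cons_iff hm h h' hup hmp] at this
            simpa [hxu, hxm] using this⟩ rfl
        refine ⟨_, .head h' hT (fun h => hup (hTp _ h)) (fun h => hmp (hTp _ h)), ?_⟩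
        rintro x (rfl | rfl | hx)
        · simp
        · simp
        · simp [hTp x hx]

theorem exists_isBalancedPath_iff {u t : V} :
    (∃ P : G.Walk u t, IsBalancedPath M P) ↔ ∃ T, BalancedReach G m t u T := by
  constructor
  · rintro ⟨P, hP⟩
    obtain ⟨T, hT, -⟩ := hP.exists_balancedReach hm
    exact ⟨T, hT⟩
  · rintro ⟨T, hT⟩
    obtain ⟨P, hP, -⟩ := hT.exists_isBalancedPath hm
    exact ⟨P, hP⟩

theorem exists_isSaturatedPath_iff {u w : V} :
    (∃ P : G.Walk u w, IsSaturatedPath M P) ↔ ∃ T, BalancedReach G m (m w) u T := by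
  constructor
  · rintro ⟨P, hP⟩
    obtain ⟨T, hT, -⟩ := hP.exists_balancedReach hm
    exact ⟨T, hT⟩
  · rintro ⟨T, hT⟩
    obtain ⟨P, hP, -⟩ := hT.exists_isSaturatedPath hm
    have : ∃ P : G.Walk u (m (m w)), IsSaturatedPath M P := ⟨P, hP⟩
    rw [partner_partner hm] at this
    exact this

end BalancedReach

/-! ### Odd components as subsets of `V`, and Tutte's theorem in these terms. -/

section ComponentSets

variable {V : Type u} {G : SimpleGraph V}

/-- `C` is the vertex set of a connected component of the subgraph of `G` induced by `S`, expressed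
as a minimal non-empty set that is closed under adjacency in `S`. -/
structure IsComponentSet (G : SimpleGraph V) (S C : Set V) : Prop where
  subset : C ⊆ S
  nonempty : C.Nonempty
  closed : ∀ a ∈ C, ∀ b ∈ S, G.Adj a b → b ∈ C
  minimal : ∀ C' ⊆ C, C'.Nonempty → (∀ a ∈ C', ∀ b ∈ S, G.Adj a b → b ∈ C') → C' = C

/-- The vertex sets of the odd components of the subgraph induced by `S`. -/
def oddComponentSets (G : SimpleGraph V) (S : Set V) : Set (Set V) :=
  {C | G.IsComponentSet S C ∧ Odd C.ncard}

theorem IsComponentSet.eq_of_mem {S C C' : Set V} (h : G.IsComponentSet S C)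
    (h' : G.IsComponentSet S C') {a : V} (ha : a ∈ C) (ha' : a ∈ C') : C = C' := by
  have hcl : ∀ a ∈ C ∩ C', ∀ b ∈ S, G.Adj a b → b ∈ C ∩ C' := fun a ha b hb hab =>
    ⟨h.closed a ha.1 b hb hab, h'.closed a ha.2 b hb hab⟩
  rw [← h.minimal _ Set.inter_subset_left ⟨a, ha, ha'⟩ hcl,
    h'.minimal _ Set.inter_subset_right ⟨a, ha, ha'⟩ hcl]

variable {W : Type u} {Q : SimpleGraph W} {f : W → V}

theorem isComponentSet_image_supp (hQ : ∀ a b, Q.Adj a b ↔ G.Adj (f a) (f b))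
    (K : Q.ConnectedComponent) : G.IsComponentSet (Set.range f) (f '' K.supp) where
  subset := Set.image_subset_range _ _
  nonempty := K.nonempty_supp.image f
  closed := by
    rintro _ ⟨a, ha, rfl⟩ _ ⟨b, rfl⟩ hab
    exact ⟨b, K.mem_supp_of_adj_mem_supp ha ((hQ a b).mpr hab), rfl⟩
  minimal := by
    rintro C' hC' ⟨c, hc⟩ hcl
    refine hC'.antisymm ?_
    obtain ⟨a, ha, rfl⟩ := hC' hc
    rintro _ ⟨b, hb, rfl⟩
    obtain ⟨w⟩ : Q.Reachable a b := ConnectedComponent.exact (Eq.trans ha (Eq.symm hb))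
    clear ha hb
    induction w with
    | nil => exact hc
    | cons h _ ih => exact ih (hcl _ hc _ ⟨_, rfl⟩ ((hQ _ _).mp h))

theorem IsComponentSet.exists_eq_image_supp
    (hQ : ∀ a b, Q.Adj a b ↔ G.Adj (f a) (f b)) {C : Set V}
    (hC : G.IsComponentSet (Set.range f) C) : ∃ K : Q.ConnectedComponent, f '' K.supp = C := by
  obtain ⟨c, hc⟩ := hC.nonempty
  obtain ⟨a, rfl⟩ := hC.subset hc
  exact ⟨Q.connectedComponentMk a,
    (isComponentSet_image_supp hQ _).eq_of_mem hC ⟨a, rfl, rfl⟩ hc⟩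

/-- Transfers counts from graphs on nested subtypes to subsets of `V`, where components of different
vertex-deleted subgraphs can be compared. -/
theorem ncard_oddComponentSets (hf : f.Injective)
    (hQ : ∀ a b, Q.Adj a b ↔ G.Adj (f a) (f b)) :
    (G.oddComponentSets (Set.range f)).ncard = Q.oddComponents.ncard := by
  have : G.oddComponentSets (Set.range f) =
      (fun K : Q.ConnectedComponent => f '' K.supp) '' Q.oddComponents := by
    ext C
    constructor
    · rintro ⟨hC, hodd⟩
      obtain ⟨K, rfl⟩ := hC.exists_eq_image_supp hQ
      rw [Set.ncard_image_of_injective _ hf] at hodd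
      exact ⟨K, hodd, rfl⟩
    · rintro ⟨K, hK, rfl⟩
      refine ⟨isComponentSet_image_supp hQ K, ?_⟩
      rw [Set.ncard_image_of_injective _ hf]
      exact hK
  rw [this, Set.ncard_image_of_injective]
  intro K K' h
  exact ConnectedComponent.supp_injective (hf.image_injective h)

theorem odd_ncard_oddComponentSets [Finite V] (S : Set V) :
    Odd (G.oddComponentSets S).ncard ↔ Odd S.ncard := by
  have h := ncard_oddComponentSets (G := G) (Q := G.induce S) (f := Subtype.val)
    Subtype.val_injective (fun _ _ => Iff.rfl)
  rw [Subtype.range_coe] at h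
  rw [h, odd_ncard_oddComponents]
  rfl

/-- Tutte's theorem for the subgraph induced by a set of even size. -/
theorem exists_partner_of_ncard_oddComponentSets_le [Finite V] {S : Set V} (hS : Even S.ncard)
    (h : ∀ U ⊆ S, (G.oddComponentSets (S \ U)).ncard ≤ U.ncard + 1) :
    ∃ n : V → V, ∀ a ∈ S, n a ∈ S ∧ n (n a) = a ∧ G.Adj a (n a) := by
  classical
  obtain ⟨N, hN⟩ : ∃ N : (G.induce S).Subgraph, N.IsPerfectMatching := by
    rw [tutte]
    intro u hu
    let f : ((⊤ : (G.induce S).Subgraph).deleteVerts u).verts → V := fun a => a.1.1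
    have hf : f.Injective := Subtype.val_injective.comp Subtype.val_injective
    have hr : Set.range f = S \ (Subtype.val '' u) := by
      ext x
      constructor
      · rintro ⟨⟨⟨x, hx⟩, -, hxu⟩, rfl⟩
        refine ⟨hx, ?_⟩
        rintro ⟨⟨y, hy⟩, hyu, rfl⟩
        exact hxu hyu
      · rintro ⟨hx, hxu⟩
        exact ⟨⟨⟨x, hx⟩, trivial, fun h => hxu ⟨_, h, rfl⟩⟩, rfl⟩
    have hcard := ncard_oddComponentSets (G := G)
      (Q := ((⊤ : (G.induce S).Subgraph).deleteVerts u).coe) hf (fun a b => by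
        have ha := a.2
        have hb := b.2
        simp only [Subgraph.deleteVerts_verts, Subgraph.verts_top] at ha hb
        simp [f, ha.2, hb.2])
    have hsub : Subtype.val '' u ⊆ S := by rintro _ ⟨y, -, rfl⟩; exact y.2
    have hu' : (Subtype.val '' u).ncard = u.ncard :=
      Set.ncard_image_of_injective _ Subtype.val_injective
    have hle := h _ hsub
    have hpar := odd_ncard_oddComponentSets (G := G) (S \ (Subtype.val '' u))
    have hdiff := Set.ncard_sdiff_add_ncard_of_subset hsub
    rw [hr] at hcard
    unfold IsTutteViolator at hu
    rw [← hcard] at hu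
    rw [hu'] at hle hdiff
    -- A Tutte violator can only have this value. Since `S` is even, the number of odd components
    -- has the parity of `u.ncard`, so an excess of exactly one is impossible.
    have heq : (G.oddComponentSets (S \ (Subtype.val '' u))).ncard = u.ncard + 1 := by omega
    rw [heq] at hpar
    rw [← hdiff] at hS
    simp only [Nat.odd_add_one, Nat.even_add, ← Nat.not_even_iff_odd] at hpar hS
    tauto
  rw [Subgraph.isPerfectMatching_iff] at hN
  choose g hg hg' using fun v => (hN v)
  refine ⟨fun a => if h : a ∈ S then g ⟨a, h⟩ else a, fun a ha => ?_⟩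
  have : g (g ⟨a, ha⟩) = ⟨a, ha⟩ := (hg' _ _ (hg ⟨a, ha⟩).symm).symm
  simp only [ha, dite_true, Subtype.coe_prop, Subtype.coe_eta, this, true_and]
  exact (hg ⟨a, ha⟩).adj_sub

end ComponentSets

/-! ### Factor-critical odd components and the matching of a barrier. -/

section Barrier

variable {V : Type u} {G : SimpleGraph V} {X : Set V}

/-- The vertex set in `G` of an odd component of `G - X`. -/
def OddComponent.verts (K : G.OddComponent X) : Set V := Subtype.val '' K.1.supp

theorem OddComponent.isComponentSet (K : G.OddComponent X) : G.IsComponentSet Xᶜ K.verts := by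
  have := isComponentSet_image_supp (G := G) (f := (Subtype.val : ↥Xᶜ → V))
    (fun _ _ => Iff.rfl) K.1
  rwa [Subtype.range_coe] at this

theorem OddComponent.odd_ncard_verts (K : G.OddComponent X) : Odd K.verts.ncard := by
  rw [OddComponent.verts, Set.ncard_image_of_injective _ Subtype.val_injective]
  exact K.2

theorem OddComponent.eq_of_mem {K L : G.OddComponent X} {a : V} (hK : a ∈ K.verts)
    (hL : a ∈ L.verts) : K = L := by
  have h := K.isComponentSet.eq_of_mem L.isComponentSet hK hL
  exact Subtype.ext (ConnectedComponent.supp_injective (Subtype.val_injective.image_injective h))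

theorem mem_oddVerts_iff {a : V} : a ∈ G.oddVerts X ↔ ∃ K : G.OddComponent X, a ∈ K.verts := by
  constructor
  · rintro ⟨h, K, hK⟩
    exact ⟨K, _, hK, rfl⟩
  · rintro ⟨K, ⟨a, h⟩, hK, rfl⟩
    exact ⟨h, K, hK⟩

theorem card_oddComponent (X : Set V) :
    Nat.card (G.OddComponent X) = (G.oddComponentSets Xᶜ).ncard := by
  have h := ncard_oddComponentSets (G := G) (f := (Subtype.val : ↥Xᶜ → V)) (Q := G.induce Xᶜ)
    Subtype.val_injective (fun _ _ => Iff.rfl)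
  rw [Subtype.range_coe] at h
  rw [h]
  rfl

/-- Odd components of `G - X` are factor-critical if `X` is an odd-maximal barrier. -/
theorem IsOddMaximalBarrier.exists_partner [Finite V] (hX : G.IsOddMaximalBarrier X)
    (K : G.OddComponent X) {z : V} (hz : z ∈ K.verts) :
    ∃ n : V → V, ∀ a ∈ K.verts \ {z}, n a ∈ K.verts \ {z} ∧ n (n a) = a ∧ G.Adj a (n a) := by
  refine exists_partner_of_ncard_oddComponentSets_le ?_ fun U hU => ?_
  · have h := Set.ncard_sdiff_singleton_add_one hz
    have hodd := K.odd_ncard_verts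
    rw [← h, Nat.odd_add_one, Nat.not_odd_iff_even] at hodd
    exact hodd
  · by_contra! hlt
    have hK := K.isComponentSet
    -- Failure at `U` means at least `U.ncard + 2` odd components. Adding `Y` to `X` trades the
    -- component `K` for these at the cost of `U.ncard + 1` vertices, so the surplus does not drop
    -- and `X ∪ Y` is a barrier, against odd-maximality.
    set Y := insert z U with hY
    have hYK : Y ⊆ K.verts := Set.insert_subset hz fun a ha => (hU ha).1
    have hXK : Disjoint X K.verts :=
      Set.disjoint_left.mpr fun a ha hk => hK.subset hk ha
    refine hX.2 Y (fun a ha => mem_oddVerts_iff.mpr ⟨K, hYK ha⟩) ⟨z, .inl rfl⟩ fun Z =>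
      (hX.1 Z).trans ?_
    have hdiff : (K.verts \ {z}) \ U = K.verts \ Y := by
      rw [hY, Set.insert_eq, Set.sdiff_sdiff]
    rw [hdiff] at hlt
    have hsub : (G.oddComponentSets Xᶜ \ {K.verts}) ∪ G.oddComponentSets (K.verts \ Y) ⊆
        G.oddComponentSets (X ∪ Y)ᶜ := by
      rintro C (⟨⟨hC, hodd⟩, hCK⟩ | ⟨hC, hodd⟩)
      · have hCY : ∀ a ∈ C, a ∉ Y := fun a ha haY => hCK (hC.eq_of_mem hK ha (hYK haY))
        refine ⟨⟨fun a ha => ?_, hC.nonempty, fun a ha b hb hab => ?_,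
          fun C' hC' hne hcl => hC.minimal C' hC' hne fun a ha b hb hab => hcl a ha b ?_ hab⟩, hodd⟩
        · exact fun h => h.elim (hC.subset ha) (hCY a ha)
        · exact hC.closed a ha b (fun h => hb (.inl h)) hab
        · exact fun h => h.elim hb (hCY b (hC.closed a (hC' ha) b hb hab))
      · refine ⟨⟨fun a ha => ?_, hC.nonempty, fun a ha b hb hab => ?_,
          fun C' hC' hne hcl => hC.minimal C' hC' hne fun a ha b hb hab => hcl a ha b ?_ hab⟩, hodd⟩
        · exact fun h => h.elim (hK.subset (hC.subset ha).1) (hC.subset ha).2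
        · exact hC.closed a ha b ⟨hK.closed a (hC.subset ha).1 b (fun h => hb (.inl h)) hab,
            fun h => hb (.inr h)⟩ hab
        · exact fun h => h.elim (hK.subset hb.1) hb.2
    have hdisj : Disjoint (G.oddComponentSets Xᶜ \ {K.verts})
        (G.oddComponentSets (K.verts \ Y)) := by
      rw [Set.disjoint_left]
      rintro C ⟨⟨hC, -⟩, hCK⟩ ⟨hC', -⟩
      obtain ⟨a, ha⟩ := hC.nonempty
      exact hCK (hC.eq_of_mem hK ha (hC'.subset ha).1)
    have h₁ := Set.ncard_le_ncard hsub
    rw [Set.ncard_union_eq hdisj] at h₁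
    have h₂ := Set.ncard_sdiff_singleton_add_one (s := G.oddComponentSets Xᶜ)
      ⟨hK, K.odd_ncard_verts⟩
    have h₃ : (X ∪ Y).ncard = X.ncard + Y.ncard :=
      Set.ncard_union_eq (hXK.mono_right hYK)
    have h₄ : Y.ncard = U.ncard + 1 := Set.ncard_insert_of_notMem fun h => (hU h).2 rfl
    unfold oddSurplus
    rw [card_oddComponent, card_oddComponent]
    omega

variable {m : V → V}

theorem even_ncard_of_partner [Finite V] {S : Set V} (hS : ∀ a ∈ S, m a ∈ S)
    (hmm : ∀ a, m (m a) = a) (hne : ∀ a, m a ≠ a) : Even S.ncard := by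
  classical
  have hfin := S.toFinite
  -- The ones cancel in pairs modulo 2 under the fixed-point-free involution `m`.
  have h : ∑ _a ∈ hfin.toFinset, (1 : ZMod 2) = 0 :=
    Finset.sum_involution (fun a _ => m a) (fun _ _ => by decide) (fun a _ _ => hne a)
      (fun a ha => by simpa using hS a (by simpa using ha)) (fun a _ => hmm a)
  rw [Finset.sum_const, nsmul_one, ZMod.natCast_eq_zero_iff_even] at h
  rwa [Set.ncard_eq_toFinset_card S hfin]

/-- A perfect matching matches the vertices of a barrier bijectively to the odd components. -/
theorem IsBarrier.exists_equiv [Finite V] (hX : G.IsBarrier X) (hmm : ∀ a, m (m a) = a)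
    (hadj : ∀ a, G.Adj a (m a)) :
    ∃ e : X ≃ G.OddComponent X, ∀ x : X, m x ∈ (e x).verts := by
  have hex : ∀ K : G.OddComponent X, ∃ x : X, m x ∈ K.verts := fun K => by
    by_contra! hno
    -- If no vertex of `K` had its partner in `X`, the odd set `K.verts` would be paired up by `m`.
    have hcl : ∀ a ∈ K.verts, m a ∈ K.verts := fun a ha =>
      K.isComponentSet.closed a ha _ (fun h => hno ⟨m a, h⟩ (by simpa [hmm] using ha)) (hadj a)
    refine Nat.not_even_iff_odd.mpr K.odd_ncard_verts ?_
    exact even_ncard_of_partner hcl hmm fun a => (hadj a).ne'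
  choose g hg using hex
  have hinj : g.Injective := fun K L h => OddComponent.eq_of_mem (hg K) (h ▸ hg L)
  have hcard : Nat.card X ≤ Nat.card (G.OddComponent X) := by
    -- The surplus of `∅` is non-negative, hence so is that of `X`.
    have h := hX ∅
    unfold oddSurplus at h
    rw [Set.ncard_empty] at h
    rw [Nat.card_coe_set_eq]
    omega
  have hbij : g.Bijective := hinj.bijective_of_nat_card_le hcard
  refine ⟨(Equiv.ofBijective g hbij).symm, fun x => ?_⟩
  have := hg ((Equiv.ofBijective g hbij).symm x)
  rwa [Equiv.ofBijective_apply_symm_apply g hbij x] at this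

end Barrier

/-! ### Projecting alternating paths to the digraph and lifting them back. -/

section Cells

variable {V : Type u} {G : SimpleGraph V} {m : V → V}

/-- Two near-perfect matchings of `S`, missing `m u` and `z` respectively, give an alternating path
in `S` between these two vertices; it is prefixed to a path that starts at the partner of `z`. -/
theorem BalancedReach.extend [Finite V] (hmm : ∀ a, m (m a) = a) (hne : ∀ a, m a ≠ a) {n : V → V} {t z : V}
    {T T' : Set V} (hz : BalancedReach G m t (m z) T') (hT' : T' ⊆ T ∪ {z, m z}) {S : Set V} {u : V}
    (hmu : m u ∈ S) (hzS : z ∈ S) (hu : u ∉ S) (huT : u ∉ T) (hST : Disjoint S T)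
    (hmS : ∀ a ∈ S, a ≠ m u → m a ∈ S)
    (hn : ∀ a ∈ S \ {z}, n a ∈ S \ {z} ∧ n (n a) = a ∧ G.Adj a (n a)) :
    ∃ T'', BalancedReach G m t u T'' ∧ T'' ⊆ T ∪ insert u S := by
  induction hc : S.ncard using Nat.strong_induction_on generalizing S u with
  | _ c ih =>
    subst hc
    have hinj : ∀ a b, m a = m b → a = b := fun a b h => by rw [← hmm a, h, hmm]
    by_cases hzu : z = m u
    · subst hzu
      rw [hmm] at hz hT'
      refine ⟨T', hz, hT'.trans (Set.union_subset_union_right _ ?_)⟩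
      rintro x (rfl | rfl)
      · exact .inr hzS
      · exact .inl rfl
    · set y := m u with hy
      set a := n y with ha
      obtain ⟨⟨haS, haz⟩, hay, hya⟩ := hn y ⟨hmu, fun h => hzu h.symm⟩
      change a ∈ S at haS
      change n a = y at hay
      change G.Adj y a at hya
      replace haz : a ≠ z := haz
      have hmaS : m a ∈ S := hmS a haS hya.ne'
      have hbne : m a ≠ y := fun h => hu (hinj _ _ h ▸ haS)
      have hbna : m a ≠ a := hne a
      -- The path begins `u`, `y`, `a`. With `y` and `a` removed, `a` takes the role of `u`: in the
      -- rest `m` fails only at `m a`, and `n` still misses only `z`.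
      have hsub : S \ {y, a} ⊂ S := ⟨Set.sdiff_subset, fun h => (h hmu).2 (.inl rfl)⟩
      have hmS' : ∀ c ∈ S \ {y, a}, c ≠ m a → m c ∈ S \ {y, a} := by
        rintro c ⟨hcS, hc⟩ hca
        simp only [Set.mem_insert_iff, Set.mem_singleton_iff, not_or] at hc
        refine ⟨hmS c hcS hc.1, ?_⟩
        rintro (h | h)
        · exact hu (hinj _ _ h ▸ hcS)
        · exact hca (by rw [← h, hmm])
      have hn' : ∀ c ∈ (S \ {y, a}) \ {z},
          n c ∈ (S \ {y, a}) \ {z} ∧ n (n c) = c ∧ G.Adj c (n c) := by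
        rintro c ⟨⟨hcS, hc⟩, hcz⟩
        simp only [Set.mem_insert_iff, Set.mem_singleton_iff, not_or] at hc
        obtain ⟨⟨h₁, h₂⟩, h₃, h₄⟩ := hn c ⟨hcS, hcz⟩
        refine ⟨⟨⟨h₁, ?_⟩, h₂⟩, h₃, h₄⟩
        rintro (h | h)
        · exact hc.2 (by rw [← h₃, h])
        · exact hc.1 (by rw [← h₃, h, hay])
      obtain ⟨T'', hT'', hsub''⟩ := ih _ (Set.ncard_lt_ncard hsub) (S := S \ {y, a}) (u := a)
        ⟨hmaS, by simp [hbne, hbna]⟩ ⟨hzS, by simp [hzu, haz.symm]⟩ (by simp)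
        (fun h => Set.disjoint_left.mp hST haS h) (hST.mono_left Set.sdiff_subset) hmS' hn' rfl
      have hnot : ∀ x, x ∉ T → x ∉ insert a (S \ {y, a}) → x ∉ T'' := fun x h₁ h₂ h =>
        (hsub'' h).elim h₁ h₂
      refine ⟨_, .head hya hT'' (hnot _ huT ?_)
        (hnot _ (Set.disjoint_left.mp hST hmu) ?_), ?_⟩
      · rintro (h | h)
        · exact hu (h ▸ haS)
        · exact hu h.1
      · rintro (h | h)
        · exact hya.ne h
        · exact h.2 (.inl rfl)
      · rintro x (rfl | rfl | hx)
        · exact .inr (.inl rfl)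
        · exact .inr (.inr hmu)
        · rcases hsub'' hx with hx | rfl | hx
          · exact .inl hx
          · exact .inr (.inr haS)
          · exact .inr (.inr hx.1)

variable {X : Set V}

theorem barrierGraph_isSumBipartite : (G.barrierGraph X).IsSumBipartite where
  left x y h := by
    obtain ⟨-, ⟨_, _, _, -, h, -⟩ | ⟨_, _, _, -, h, -⟩⟩ := h <;> cases h
  right x y h := by
    obtain ⟨-, ⟨_, _, _, h, -⟩ | ⟨_, _, _, h, -⟩⟩ := h <;> cases h

theorem barrierGraph_adj {x : X} {K : G.OddComponent X} :
    (G.barrierGraph X).Adj (.inl x) (.inr K) ↔ ∃ y ∈ K.verts, G.Adj x y := by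
  constructor
  · rintro ⟨-, ⟨x', K', y, hx, hK, hy, h⟩ | ⟨_, _, _, h, -⟩⟩
    · cases hx
      cases hK
      exact ⟨y, ⟨y, hy, rfl⟩, h⟩
    · cases h
  · rintro ⟨_, ⟨y, hy, rfl⟩, h⟩
    exact ⟨by simp, .inl ⟨x, K, y, rfl, rfl, hy, h⟩⟩

theorem mem_expansion_of_mem {a : V} (ha : a ∈ X) {D : G.DMComponent X} :
    a ∈ (G.expansion X D).verts ↔
      (G.barrierGraph X).allowedGraph.connectedComponentMk (.inl ⟨a, ha⟩) = D := by
  constructor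
  · rintro (⟨_, h⟩ | ⟨h, -⟩)
    · exact h
    · exact (h ha).elim
  · exact fun h => .inl ⟨ha, h⟩

theorem mem_expansion_of_mem_verts {a : V} {K : G.OddComponent X} (ha : a ∈ K.verts)
    {D : G.DMComponent X} :
    a ∈ (G.expansion X D).verts ↔
      (G.barrierGraph X).allowedGraph.connectedComponentMk (.inr K) = D := by
  constructor
  · rintro (⟨h, -⟩ | ⟨h, L, hL, hD⟩)
    · exact (K.isComponentSet.subset ha h).elim
    · rw [OddComponent.eq_of_mem ha (L := L) ⟨_, hL, rfl⟩]
      exact hD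
  · obtain ⟨a, ha, rfl⟩ := ha
    exact fun h => .inr ⟨a.2, K, ha, h⟩

/-- The vertex `x` of a barrier together with the odd component matched to it. -/
def barrierCell (e : X ≃ G.OddComponent X) (x : X) : Set V := insert ↑x (e x).verts

variable {e : X ≃ G.OddComponent X}

theorem eq_of_mem_barrierCell {x y : X} {a : V} (hx : a ∈ barrierCell e x)
    (hy : a ∈ barrierCell e y) : x = y := by
  rcases hx with rfl | hx <;> rcases hy with hy | hy
  · exact Subtype.ext hy
  · exact ((e y).isComponentSet.subset hy x.2).elim
  · exact ((e x).isComponentSet.subset hx (hy ▸ y.2)).elim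
  · exact e.injective (OddComponent.eq_of_mem hx hy)

variable (hmm : ∀ a, m (m a) = a) (hadj : ∀ a, G.Adj a (m a)) (he : ∀ x : X, m x ∈ (e x).verts)
include hmm hadj he

theorem partner_mem_verts {x : X} {a : V} (ha : a ∈ (e x).verts) (hax : a ≠ m x) :
    m a ∈ (e x).verts := by
  refine (e x).isComponentSet.closed a ha _ (fun h => hax ?_) (hadj a)
  have h₁ := he ⟨m a, h⟩
  change m (m a) ∈ _ at h₁
  rw [hmm] at h₁
  have h₂ : x = ⟨m a, h⟩ := e.injective (OddComponent.eq_of_mem ha h₁)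
  rw [h₂]
  exact (hmm a).symm

/-- Within `e x` only `m x` is matched outside, namely to `x`. The condition `u = x ∨ ↑x ∉ T` rules
out returning to `x`, so the component is left by a non-matching edge into `X`, which is an arc of
the digraph. -/
theorem BalancedReach.partnerReach {t u : V} {T : Set V} (h : BalancedReach G m t u T) {x : X}
    (hu : u ∈ barrierCell e x) (hx : u = x ∨ ↑x ∉ T) :
    ∃ y, t ∈ barrierCell e y ∧ (G.barrierGraph X).PartnerReach e x y := by
  induction h generalizing x with
  | refl => exact ⟨x, hu, .refl⟩
  | @head u b T h₁ h₂ h₃ h₄ ih =>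
    have hxT : ↑x ∉ T := by
      rcases hx with rfl | hx
      · exact h₃
      · exact fun h => hx (.inr (.inr h))
    have hmu : m u ∈ (e x).verts := by
      rcases hx with rfl | hx
      · exact he x
      · rcases hu with rfl | hu
        · exact he x
        · refine partner_mem_verts hmm hadj he hu ?_
          rintro rfl
          exact hx (.inr (.inl (hmm x).symm))
    by_cases hb : b ∈ X
    · obtain ⟨y, hy, hr⟩ := ih (x := ⟨b, hb⟩) (.inl rfl) (.inl rfl)
      exact ⟨y, hy, .head (barrierGraph_adj.mpr ⟨_, hmu, h₁.symm⟩).symm hr⟩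
    · exact ih (.inr ((e x).isComponentSet.closed _ hmu b hb h₁)) (.inr hxT)

/-- Crosses one cell from `x` to a prescribed exit `z`, by factor-criticality at `z`. The given path
may already use `z` and `m z`; only `T` has to avoid the cell. -/
theorem exists_balancedReach_of_mem_verts [Finite V] (hX : G.IsOddMaximalBarrier X) {x : X}
    {t z : V} (hz : z ∈ (e x).verts) {T T' : Set V} (hT : BalancedReach G m t (m z) T')
    (hT' : T' ⊆ T ∪ {z, m z}) (hdisj : Disjoint (barrierCell e x) T) :
    ∃ T'', BalancedReach G m t x T'' ∧ T'' ⊆ T ∪ barrierCell e x := by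
  obtain ⟨n, hn⟩ := hX.exists_partner (e x) hz
  exact hT.extend hmm (fun a => (hadj a).ne') hT' (he x) hz (fun h => (e x).isComponentSet.subset h x.2)
    (Set.disjoint_left.mp hdisj (.inl rfl)) (hdisj.mono_left (Set.subset_insert _ _))
    (fun a ha hax => partner_mem_verts hmm hadj he ha hax) hn

/-- A simple directed path visits each cell at most once and cells are disjoint, so the pieces
lifted cell by cell form a path. -/
theorem exists_balancedReach_of_partnerReach [Finite V] (hX : G.IsOddMaximalBarrier X) {x y : X}
    (h : (G.barrierGraph X).PartnerReach e x y) {t : V} {T : Set V}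
    (hT : BalancedReach G m t y T) (hTy : T ⊆ barrierCell e y) :
    ∃ T', BalancedReach G m t x T' := by
  obtain ⟨S, hS⟩ := SimpleReach.of_reflTransGen h
  suffices ∃ T', BalancedReach G m t x T' ∧ T' ⊆ ⋃ s ∈ S, barrierCell e s from
    this.imp fun _ h => h.1
  clear h
  induction hS with
  | refl => exact ⟨T, hT, by simpa using hTy⟩
  | @head a b S hab _ haS ih =>
    obtain ⟨T₁, hT₁, hsub⟩ := ih
    have hdisj : Disjoint (barrierCell e a) T₁ := by
      rw [Set.disjoint_left]
      intro v hva hv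
      obtain ⟨s, hs, hvs⟩ := Set.mem_iUnion₂.mp (hsub hv)
      exact haS (eq_of_mem_barrierCell hva hvs ▸ hs)
    obtain ⟨z, hz, hbz⟩ := barrierGraph_adj.mp hab.symm
    have hmz : m z ∈ barrierCell e a := by
      by_cases hza : z = m a
      · rw [hza, hmm]
        exact .inl rfl
      · exact .inr (partner_mem_verts hmm hadj he hz hza)
    have hnew : BalancedReach G m t (m z) (insert (m z) (insert (m (m z)) T₁)) := by
      refine .head (by rw [hmm]; exact hbz.symm) hT₁ (Set.disjoint_left.mp hdisj hmz) ?_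
      rw [hmm]
      exact Set.disjoint_left.mp hdisj (.inr hz)
    obtain ⟨T₂, hT₂, hsub₂⟩ := exists_balancedReach_of_mem_verts hmm hadj he hX hz hnew (T := T₁)
      (by rw [hmm]; rintro v (rfl | rfl | hv) <;> simp [*]) hdisj
    refine ⟨T₂, hT₂, hsub₂.trans ?_⟩
    rw [Set.biUnion_insert, Set.union_comm]
    exact Set.union_subset_union_right _ hsub

theorem exists_balancedReach_iff [Finite V] (hX : G.IsOddMaximalBarrier X) {x y : X} :
    (∃ T, BalancedReach G m y x T) ↔ (G.barrierGraph X).PartnerReach e x y := by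
  constructor
  · rintro ⟨T, hT⟩
    obtain ⟨y', hy', h⟩ := hT.partnerReach hmm hadj he (x := x) (.inl rfl) (.inl rfl)
    rwa [eq_of_mem_barrierCell (x := y) (.inl rfl) hy']
  · exact fun h => exists_balancedReach_of_partnerReach hmm hadj he hX h .refl (by simp [barrierCell])

theorem exists_balancedReach_partner_iff [Finite V] (hX : G.IsOddMaximalBarrier X) {x y : X}
    {w : V} (hw : w ∈ (e y).verts) :
    (∃ T, BalancedReach G m (m w) x T) ↔ (G.barrierGraph X).PartnerReach e x y := by
  have hmw : m w ∈ barrierCell e y := by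
    by_cases hwy : w = m y
    · rw [hwy, hmm]
      exact .inl rfl
    · exact .inr (partner_mem_verts hmm hadj he hw hwy)
  constructor
  · rintro ⟨T, hT⟩
    obtain ⟨y', hy', h⟩ := hT.partnerReach hmm hadj he (x := x) (.inl rfl) (.inl rfl)
    rwa [eq_of_mem_barrierCell hmw hy']
  · intro h
    -- Inside the last cell the exit is `w` and the remaining path is the single vertex `m w`.
    obtain ⟨T, hT, hsub⟩ := exists_balancedReach_of_mem_verts hmm hadj he hX hw (T := ∅)
      (.refl (t := m w)) (by simp) (by simp)
    exact exists_balancedReach_of_partnerReach hmm hadj he hX h hT (by simpa using hsub)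

end Cells

end SimpleGraph

theorem mainTheorem4 {V : Type*} [Finite V] (G : SimpleGraph V) (X : Set V)
    (hX : G.IsOddMaximalBarrier X) (M : G.Subgraph) (hM : M.IsPerfectMatching) :
    -- the DM-components and the DM-order are well defined
    (∀ a ∈ X ∪ G.oddVerts X, ∃! D : G.DMComponent X, a ∈ (G.expansion X D).verts) ∧
    (∃! le : G.DMComponent X → G.DMComponent X → Prop, G.IsBarrierDMOrder X le) ∧
    -- the characterization of reachability
    ∀ le : G.DMComponent X → G.DMComponent X → Prop, G.IsBarrierDMOrder X le →
      (∀ u ∈ X, ∀ v ∈ X, ∀ Du Dv : G.DMComponent X,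
        u ∈ (G.expansion X Du).verts → v ∈ (G.expansion X Dv).verts →
        ((∃ P : G.Walk u v, SimpleGraph.IsBalancedPath M P) ↔ le Du Dv)) ∧
      (∀ u ∈ X, ∀ w ∈ G.oddVerts X, ∀ Du Dw : G.DMComponent X,
        u ∈ (G.expansion X Du).verts → w ∈ (G.expansion X Dw).verts →
        ((∃ P : G.Walk u w, SimpleGraph.IsSaturatedPath M P) ↔ le Du Dw)) := by
  have hm' : ∀ a, ∃ b, M.Adj a b ∧ ∀ b', M.Adj a b' → b' = b :=
    SimpleGraph.Subgraph.isPerfectMatching_iff.mp hM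
  choose m hmM hmu using hm'
  have hm : ∀ a b, M.Adj a b ↔ m a = b := fun a b =>
    ⟨fun h => (hmu a b h).symm, fun h => h ▸ hmM a⟩
  have hmm : ∀ a, m (m a) = a := SimpleGraph.partner_partner hm
  have hadj : ∀ a, G.Adj a (m a) := fun a => (hmM a).adj_sub
  obtain ⟨e, he⟩ := hX.1.exists_equiv hmm hadj
  have hH := SimpleGraph.barrierGraph_isSumBipartite (G := G) (X := X)
  have heH : ∀ x, (G.barrierGraph X).Adj (.inl x) (.inr (e x)) := fun x =>
    SimpleGraph.barrierGraph_adj.mpr ⟨_, he x, hadj x⟩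
  refine ⟨?_, hH.existsUnique_isDMOrder heH, fun le hle => ⟨?_, ?_⟩⟩
  · rintro a (ha | ha)
    · exact ⟨_, (SimpleGraph.mem_expansion_of_mem ha).mpr rfl,
        fun D hD => ((SimpleGraph.mem_expansion_of_mem ha).mp hD).symm⟩
    · obtain ⟨K, hK⟩ := SimpleGraph.mem_oddVerts_iff.mp ha
      exact ⟨_, (SimpleGraph.mem_expansion_of_mem_verts hK).mpr rfl,
        fun D hD => ((SimpleGraph.mem_expansion_of_mem_verts hK).mp hD).symm⟩
  · intro u hu v hv Du Dv hDu hDv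
    rw [← (SimpleGraph.mem_expansion_of_mem hu).mp hDu,
      ← (SimpleGraph.mem_expansion_of_mem hv).mp hDv, hle.le_mk_iff hH heH,
      SimpleGraph.exists_isBalancedPath_iff hm]
    exact SimpleGraph.exists_balancedReach_iff hmm hadj he hX (x := ⟨u, hu⟩) (y := ⟨v, hv⟩)
  · intro u hu w hw Du Dw hDu hDw
    obtain ⟨K, hK⟩ := SimpleGraph.mem_oddVerts_iff.mp hw
    obtain ⟨y, rfl⟩ := e.surjective K
    rw [← (SimpleGraph.mem_expansion_of_mem hu).mp hDu,
      ← (SimpleGraph.mem_expansion_of_mem_verts hK).mp hDw, SimpleGraph.mk_inr heH,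
      hle.le_mk_iff hH heH, SimpleGraph.exists_isSaturatedPath_iff hm]
    exact SimpleGraph.exists_balancedReach_partner_iff hmm hadj he hX (x := ⟨u, hu⟩) hK
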